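/- **Setting.** Let $(\mathcal X,\mathcal A)$ be a measurable space. For each sample size $N$ let $m=m_N$, $n=n_N$ be nonrandom with $m+n=N$ and $m/N\to\pi\in(0,1)$. For each $N$ let $C_1,C_2,P_0,Q_0$ be probability measures on $\mathcal X$ with pairwise disjoint supports (they may depend on $N$), and let $p_2=p_2(N)\in(1/2,1)$ with $p_2-\tfrac12=o(N^{-1})$. For $p_1=p_1(N)\in(0,1)$ put $$P=p_1C_1+(1-p_1)p_2P_0+(1-p_1)(1-p_2)Q_0,\qquad Q=p_1C_2+(1-p_1)p_2Q_0+(1-p_1)(1-p_2)P_0,$$ and $\lambda_N=\mathrm{TV}(P,Q)=\sup_{A}|P(A)-Q(A)|$. One observes independent iid samples $X_1,\dots,X_m\sim P$ and $Y_1,\dots,Y_n\sim Q$. With densities $f,g$ of $P,Q$ with respect to $P+Q$, let $\rho^*=g/(f+g)$. Fix $\alpha\in(0,1)$. **Cutoff estimators.** Let $F,G$ be the distribution functions of $\rho^*$ under $P,Q$ and $\hat F_m,\hat G_n$ the empirical ones. For $t\in[0,1]$ let $\hat\lambda(t)=\hat F_m(t)-\hat G_n(t)-q_{1-\alpha}\sigma(t)$,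 where $q_{1-\alpha}$ is the standard normal quantile and $\sigma(t)^2=F(t)(1-F(t))/m+G(t)(1-G(t))/n$. **Adaptive estimator.** Arrange the $N$ values $\rho^*(X_i),\rho^*(Y_j)$ in nondecreasing order, ties being broken by any fixed rule (a function of the vector of values), and let $V_{m,z}$ be the number of observations from $P$ among the first $z$. Let $q_{1-\alpha/3}(l,k)$ be the $(1-\alpha/3)$-quantile of the binomial distribution with success probability $l$ and $k$ trials, $m(l)=m-q_{1-\alpha/3}(l,m)$, $n(l)=n-q_{1-\alpha/3}(l,n)$, and write $q=q_{1-\alpha/3}(l,m)$. Let $Q_{m,n,\alpha}(z,l)=z$ if $z\le q$, $Q_{m,n,\alpha}(z,l)=m$ if $z\ge m+n(l)$, and otherwise $$Q_{m,n,\alpha}(z,l)=q+(z-q)\frac{m(l)}{m(l)+n(l)}+\beta_{m(l)}\,w\big(z-q,m(l),n(l)\big),$$ $$w(z,m,n)=\sqrt{\tfrac{m}{m+n}\,\tfrac{n}{m+n}\,\tfrac{m+n-z}{m+n-1}\,z},\qquad \beta_k=\sqrt{2\log\log k}+\frac{\log\log\log k-\log\pi_0+2x}{2\sqrt{2\log\log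 k}},$$ where $\pi_0=3.14159\ldots$ and $x$ is an arbitrary real constant (the standard calibration is $x=-\log(-\log(1-\alpha/3))$); for $k\le 2$, where this expression is undefined, put $\beta_k=0$. Define $$\hat\lambda_{adapt}=\inf\{l\in[0,1]:\ V_{m,z}\le Q_{m,n,\alpha}(z,l)\ \text{for all } z\in\{1,\dots,N-1\}\}.$$ **Rates.** Let $h_1\asymp h_2$ mean that $h_1/h_2$ and $h_2/h_1$ are eventually bounded. For $\varepsilon\in(0,1]$, let $\underline\gamma^{\hat\lambda_{adapt}}(\varepsilon)$ be the infimum of the $\gamma_0\in[-1,0)$ such that for all $\gamma\in(\gamma_0,0)$ and all sequences $p_1=p_1(N)\in(0,1)$ with $\lambda_N\asymp N^\gamma$ one has $\mathbb P(\hat\lambda_{adapt}>(1-\varepsilon)\lambda_N)\to1$ as $N\to\infty$. Let $\underline\gamma^{oracle}(\varepsilon)$ be the infimum of the $\gamma_0\in[-1,0)$ such that for every $\gamma\in(\gamma_0,0)$ there is a nonrandom sequence $(t_N)\subset[0,1]$ such that $\mathbb P(\hat\lambda(t_N)>(1-\varepsilon)\lambda_N)\to1$ for all sequences $p_1$ with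 $\lambda_N\asymp N^\gamma$. **Proposition.** For every $\varepsilon\in(0,1]$, $$\underline\gamma^{\hat\lambda_{adapt}}(\varepsilon)=\underline\gamma^{oracle}(\varepsilon)=-1 .$$ -/

import Mathlib

namespace HPLB

open MeasureTheory ProbabilityTheory Filter Asymptotics
open scoped Topology

noncomputable section

/-- Total variation distance `sup_A |P A - Q A|` over the measurable sets. -/
def tvDist {X : Type*} [MeasurableSpace X] (P Q : ProbabilityMeasure X) : ℝ :=
  ⨆ A : {A : Set X // MeasurableSet A},
    |(P : Measure X).real A.1 - (Q : Measure X).real A.1|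

/-- The projection `ρ* = g / (f + g)`, where `f` and `g` are the densities of `P` and `Q` with
respect to the common dominating measure `P + Q`. -/
def bayesProjection {X : Type*} [MeasurableSpace X] (P Q : ProbabilityMeasure X) (z : X) : ℝ :=
  let ν : Measure X := (P : Measure X) + (Q : Measure X)
  let f : X → ℝ := fun y => ((P : Measure X).rnDeriv ν y).toReal
  let g : X → ℝ := fun y => ((Q : Measure X).rnDeriv ν y).toReal
  g z / (f z + g z)

/-- The joint law of two independent iid samples, of size `m` from `P` and of size `n` from `Q`. -/
def sampleLaw {X : Type*} [MeasurableSpace X] (P Q : ProbabilityMeasure X) (m n : ℕ) :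
    Measure ((Fin m → X) × (Fin n → X)) :=
  (Measure.pi fun _ : Fin m => (P : Measure X)).prod (Measure.pi fun _ : Fin n => (Q : Measure X))

/-- The `a`-quantile of the standard normal distribution. -/
def normalQuantile (a : ℝ) : ℝ := sInf {x : ℝ | a ≤ cdf (gaussianReal 0 1) x}

/-- The `a`-quantile `q_a(p, m)` of the binomial distribution with success probability `p` and
`m` trials. -/
def binomialQuantile (a : ℝ) (p : unitInterval) (m : ℕ) : ℕ :=
  sInf {k : ℕ | a ≤ (binomial m p).real (Set.Iic k)}

/-! ### Estimators, detection, and rates -/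

/-- An estimate computed from two samples of sizes `m` and `n`. It may depend on the underlying
pair `(P, Q)`, because the projection `ρ*` does. -/
abbrev Estimator (X : Type*) [MeasurableSpace X] : Type _ :=
  (P Q : ProbabilityMeasure X) → (m n : ℕ) → (Fin m → X) → (Fin n → X) → ℝ

/-- A sequence of pairs `(P_N, Q_N)` of probability measures. -/
abbrev Alternative (X : Type*) [MeasurableSpace X] : Type _ :=
  ℕ → ProbabilityMeasure X × ProbabilityMeasure X

/-- The total variation distances `λ_N = TV(P_N, Q_N)`. -/
def signal {X : Type*} [MeasurableSpace X] (A : Alternative X) (N : ℕ) : ℝ :=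
  tvDist (A N).1 (A N).2

/-- `ℙ(λ̂ > (1 - ε) λ_N) → 1` as `N → ∞`, where the estimate used at stage `N` is `est N`. -/
def Detects {X : Type*} [MeasurableSpace X] (m n : ℕ → ℕ) (A : Alternative X)
    (est : ℕ → Estimator X) (ε : ℝ) : Prop :=
  Tendsto (fun N => (sampleLaw (A N).1 (A N).2 (m N) (n N)).real
      {ω | (1 - ε) * signal A N < est N (A N).1 (A N).2 (m N) (n N) ω.1 ω.2})
    atTop (𝓝 1)

/-- The smallest rate attained by an estimator over a class `𝒜` of alternatives: the infimum of
the `γ₀ ∈ [-1, 0)` such that for all `γ ∈ (γ₀, 0)` and all alternatives with `λ_N ≍ N ^ γ` the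
estimator exceeds `(1 - ε) λ_N` with probability tending to one. -/
def rate {X : Type*} [MeasurableSpace X] (m n : ℕ → ℕ) (𝒜 : Set (Alternative X))
    (est : Estimator X) (ε : ℝ) : ℝ :=
  sInf {γ₀ : ℝ | γ₀ ∈ Set.Ico (-1) 0 ∧ ∀ γ ∈ Set.Ioo γ₀ 0, ∀ A ∈ 𝒜,
    signal A =Θ[atTop] (fun N : ℕ => (N : ℝ) ^ γ) → Detects m n A (fun _ => est) ε}

/-! ### The oracle estimator and the oracle rate -/

/-- Distribution function at `t` of the push-forward of `P` under `ρ`. -/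
def projCdf {X : Type*} [MeasurableSpace X] (P : ProbabilityMeasure X) (ρ : X → ℝ) (t : ℝ) : ℝ :=
  (P : Measure X).real {z | ρ z ≤ t}

/-- Empirical distribution function at `t` of `ρ(x_1), …, ρ(x_k)`. -/
def empCdf {X : Type*} {k : ℕ} (ρ : X → ℝ) (x : Fin k → X) (t : ℝ) : ℝ :=
  (1 / (k : ℝ)) * (Finset.univ.filter fun i => ρ (x i) ≤ t).card

/-- The theoretical standard deviation of `F̂_m(t) - Ĝ_n(t)`. -/
def sdev {X : Type*} [MeasurableSpace X] (P Q : ProbabilityMeasure X) (ρ : X → ℝ) (m n : ℕ)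
    (t : ℝ) : ℝ :=
  Real.sqrt (projCdf P ρ t * (1 - projCdf P ρ t) / m + projCdf Q ρ t * (1 - projCdf Q ρ t) / n)

/-- The estimator `F̂_m(t) - Ĝ_n(t) - q_{1-α} σ(t)` with cutoff `t`, for `ρ = ρ*`. -/
def cutoffEstimator (X : Type*) [MeasurableSpace X] (α t : ℝ) : Estimator X :=
  fun P Q m n x y =>
    empCdf (bayesProjection P Q) x t - empCdf (bayesProjection P Q) y t
      - normalQuantile (1 - α) * sdev P Q (bayesProjection P Q) m n t

/-- The oracle rate over a class `𝒜` of alternatives: for every larger `γ < 0` there is a nonrandom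
sequence of cutoffs `t_N ∈ [0, 1]` (which may depend on `γ`, but not otherwise on the alternative)
such that the estimator with cutoffs
`t_N` exceeds `(1 - ε) λ_N` with probability tending to one whenever `λ_N ≍ N ^ γ`. -/
def oracleRate {X : Type*} [MeasurableSpace X] (m n : ℕ → ℕ) (𝒜 : Set (Alternative X))
    (α ε : ℝ) : ℝ :=
  sInf {γ₀ : ℝ | γ₀ ∈ Set.Ico (-1) 0 ∧ ∀ γ ∈ Set.Ioo γ₀ 0,
    ∃ t : ℕ → ℝ, (∀ N, t N ∈ Set.Icc (0 : ℝ) 1) ∧ ∀ A ∈ 𝒜,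
      signal A =Θ[atTop] (fun N : ℕ => (N : ℝ) ^ γ) →
        Detects m n A (fun N => cutoffEstimator X α (t N)) ε}

/-! ### The adaptive estimator -/

/-- A rule that arranges a pooled sample of `m + n` real numbers, `m` of the first kind and `n` of
the second kind, in nondecreasing order. The freedom in it is the way in which ties are broken. -/
structure SortingRule where
  arrange : (m n : ℕ) → (Fin m ⊕ Fin n → ℝ) → (Fin (m + n) ≃ Fin m ⊕ Fin n)
  monotone : ∀ (m n : ℕ) (r : Fin m ⊕ Fin n → ℝ), Monotone fun i => r (arrange m n r i)

instance : Nonempty SortingRule :=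
  ⟨{ arrange := fun _ _ r => (Tuple.sort (r ∘ finSumFinEquiv.symm)).trans finSumFinEquiv.symm
     monotone := fun _ _ r => Tuple.monotone_sort (r ∘ finSumFinEquiv.symm) }⟩

/-- The counting function `V_{m,z}`: the number of observations of the first kind among the first
`z` elements of the arranged pooled sample. If there are no ties this is `m F̂_m(ρ_(z))`; in general
it is the version for which `V_{m,z}` plus the number of observations of the second kind is `z`. -/
def countFirst {m n : ℕ} (e : Fin (m + n) ≃ Fin m ⊕ Fin n) (z : ℕ) : ℕ :=
  (Finset.univ.filter fun i : Fin (m + n) => (i : ℕ) < z ∧ (e i).isLeft = true).card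

/-- The standard deviation `w(z, m, n)` of the hypergeometric distribution. -/
def hyperSd (z m n : ℝ) : ℝ :=
  Real.sqrt (m / (m + n) * (n / (m + n)) * ((m + n - z) / (m + n - 1)) * z)

/-- `β = √(2 log log m) + (log log log m - log π + 2 x) / (2 √(2 log log m))`. -/
def bandFactor (x : ℝ) (m : ℝ) : ℝ :=
  Real.sqrt (2 * Real.log (Real.log m))
    + (Real.log (Real.log (Real.log m)) - Real.log Real.pi + 2 * x)
      / (2 * Real.sqrt (2 * Real.log (Real.log m)))

/-- The asymptotic bounding function `Q_{m,n,α}(z, l)`, where `m(l) = m - q_{1-α/3}(l, m)`,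
`n(l) = n - q_{1-α/3}(l, n)`. The real number `x` is the quantile that enters the confidence band,
in the standard calibration the Gumbel quantile `x = -log (-log (1 - α / 3))`. -/
def boundingFunction (α x : ℝ) (m n : ℕ) (z : ℕ) (l : unitInterval) : ℝ :=
  let q : ℕ := binomialQuantile (1 - α / 3) l m
  let ml : ℕ := m - q
  let nl : ℕ := n - binomialQuantile (1 - α / 3) l n
  if z ≤ q then z
  else if m + nl ≤ z then m
  else q + (((z : ℝ) - q) * ((ml : ℝ) / ((ml : ℝ) + nl))
    + bandFactor x ml * hyperSd ((z : ℝ) - q) ml nl)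

/-- The adaptive estimator for `ρ = ρ*`: the infimum of the `l ∈ [0, 1]` with
`V_{m,z} ≤ Q_{m,n,α}(z, l)` for all `z ∈ {1, …, m + n - 1}`. -/
def adaptiveEstimator (X : Type*) [MeasurableSpace X] (S : SortingRule) (α x : ℝ) :
    Estimator X :=
  fun P Q m n xs ys =>
    let r : Fin m ⊕ Fin n → ℝ :=
      Sum.elim (fun i => bayesProjection P Q (xs i)) (fun j => bayesProjection P Q (ys j))
    let e := S.arrange m n r
    sInf {l : ℝ | ∃ p : unitInterval, (p : ℝ) = l ∧
      ∀ z ∈ Finset.Icc 1 (m + n - 1), (countFirst e z : ℝ) ≤ boundingFunction α x m n z p}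

/-! ### The contaminated mixture model -/

/-- The alternatives `P_N = p₁ C₁ + (1 - p₁) p₂ P₀ + (1 - p₁) (1 - p₂) Q₀`,
`Q_N = p₁ C₂ + (1 - p₁) p₂ Q₀ + (1 - p₁) (1 - p₂) P₀`, where the component measures and the
sequence `p₂` are given and `p₁ = p₁(N) ∈ (0, 1)` is free. -/
def mixtureClass {X : Type*} [MeasurableSpace X] (C₁ C₂ P₀ Q₀ : ℕ → ProbabilityMeasure X)
    (p₂ : ℕ → ℝ) : Set (Alternative X) :=
  {A | ∃ p₁ : ℕ → ℝ, ∀ N, p₁ N ∈ Set.Ioo (0 : ℝ) 1 ∧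
    ((A N).1 : Measure X) =
      ENNReal.ofReal (p₁ N) • (C₁ N : Measure X)
        + ENNReal.ofReal ((1 - p₁ N) * p₂ N) • (P₀ N : Measure X)
        + ENNReal.ofReal ((1 - p₁ N) * (1 - p₂ N)) • (Q₀ N : Measure X) ∧
    ((A N).2 : Measure X) =
      ENNReal.ofReal (p₁ N) • (C₂ N : Measure X)
        + ENNReal.ofReal ((1 - p₁ N) * p₂ N) • (Q₀ N : Measure X)
        + ENNReal.ofReal ((1 - p₁ N) * (1 - p₂ N)) • (P₀ N : Measure X)}

/-- Four probability measures with pairwise disjoint supports: they are carried by pairwise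
disjoint measurable sets. -/
def DisjointSupports {X : Type*} [MeasurableSpace X] (μ : Fin 4 → ProbabilityMeasure X) : Prop :=
  ∃ s : Fin 4 → Set X, (∀ i, MeasurableSet (s i)) ∧ Pairwise (fun i j => Disjoint (s i) (s j)) ∧
    ∀ i, (μ i : Measure X) (s i)ᶜ = 0

end

end HPLB

namespace HPLB

open MeasureTheory ProbabilityTheory Filter Asymptotics
open scoped Topology

/-! ### Binomial quantiles -/

/-! Everything happens on the region `Z = {ρ* ≤ 0}`, which is `Q`-null. Up to a `P`-null set it
contains the carrier of `C₁`, so `P(Z) ≥ p₁`, while `TV(P,Q) ≤ p₁ + (2p₂ - 1)`. Since `2p₂ - 1 =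
o(1/N)`, `P(Z)` equals `λ` up to a factor `1 - o(1)` whenever `λ ≍ N^γ` with `γ > -1`
(`tvDist_le_of_mixture`, `eventually_mul_signal_le`). Then `mλ → ∞`, so by Chebyshev the number `T`
of first-sample points in `Z` is about `mλ`, while almost surely no second-sample point falls in `Z`
(`le_sampleLaw_real`). Detection thus becomes a deterministic inequality on this event
(`detects_of_eventually`).

Cutoff at `t = 0`: the estimate is `T/m` minus a multiple of `σ(0) ≤ √(λ/m) = λ/√(mλ)`, which is
`o(λ)`.

Adaptive estimator: the first `T` sorted points all come from `P`, so `V_{m,T} ≥ T`. If `l ≤ (1 -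
ε/2)λ`, the binomial quantile `q` leaves an excess `D = T - q` of order `mλ`. The bounding function
at `T` is at most `q + (1 - κ)D + β√D`, which is below `T` because `β` grows more slowly than any
power of `N`. So no such `l` is feasible, and the infimum is at least `(1 - ε/2)λ`
(`boundingFunction_lt_of_le_signal`, `le_adaptiveEstimator`).

Both rates are then `-1`: this value is admissible, and nothing smaller is allowed by definition. -/

lemma integral_sq_sub_binomial (m : ℕ) (p : unitInterval) :
    ∫ k : ℕ, ((k : ℝ) - m * p) ^ 2 ∂(binomial m p) = m * p * (1 - p) := by
  rw [integral_binomial]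
  have h := congrArg (Polynomial.eval (p : ℝ)) (bernsteinPolynomial.variance ℝ m)
  simp only [Polynomial.eval_finsetSum, bernsteinPolynomial, nsmul_eq_mul, Polynomial.eval_mul,
    Polynomial.eval_pow, Polynomial.eval_sub, Polynomial.eval_natCast, Polynomial.eval_X,
    Polynomial.eval_one] at h
  rw [← h, ← Nat.range_succ_eq_Iic]
  exact Finset.sum_congr rfl fun k _ => by rw [smul_eq_mul]; ring

lemma binomial_real_upper_tail_le (m : ℕ) (p : unitInterval) {t : ℝ} (ht : 0 < t) :
    (binomial m p).real {k : ℕ | (m : ℝ) * p + t ≤ k} ≤ m * p / t ^ 2 := by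
  have hp0 : (0 : ℝ) ≤ p := p.2.1
  have hM := mul_meas_ge_le_integral_of_nonneg (μ := binomial m p)
    (f := fun k : ℕ => ((k : ℝ) - m * p) ^ 2)
    (Eventually.of_forall fun _ => sq_nonneg _) (integrable_binomial _) (t ^ 2)
  rw [integral_sq_sub_binomial] at hM
  have hsub : (binomial m p).real {k : ℕ | (m : ℝ) * p + t ≤ k} ≤
      (binomial m p).real {k : ℕ | t ^ 2 ≤ ((k : ℝ) - m * p) ^ 2} := by
    refine measureReal_mono (fun k hk => ?_)
    have hk' : t ≤ (k : ℝ) - m * p := by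
      have : (m : ℝ) * p + t ≤ k := hk
      linarith
    exact pow_le_pow_left₀ ht.le hk' 2
  rw [le_div_iff₀ (by positivity)]
  have hmp : 0 ≤ (m : ℝ) * p := by positivity
  nlinarith [sq_nonneg t]

/-- Chebyshev: the deviation is chosen to make the upper tail at most `1 - a`. The `+ 1` keeps it
positive when `m * p = 0`. -/
lemma binomialQuantile_le {a : ℝ} (ha : a < 1) (m : ℕ) (p : unitInterval) :
    (binomialQuantile a p m : ℝ) ≤ m * p + Real.sqrt ((m * p + 1) / (1 - a)) := by
  have hp0 : (0 : ℝ) ≤ p := p.2.1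
  have h1a : 0 < 1 - a := by linarith
  set t := Real.sqrt ((m * p + 1) / (1 - a)) with htdef
  have ht : 0 < t := Real.sqrt_pos.2 (by positivity)
  have hts : t ^ 2 = (m * p + 1) / (1 - a) := Real.sq_sqrt (by positivity)
  have hle : binomialQuantile a p m ≤ ⌊(m : ℝ) * p + t⌋₊ := by
    refine Nat.sInf_le ?_
    have htail := binomial_real_upper_tail_le m p ht
    have hle1 : (m : ℝ) * p / t ^ 2 ≤ 1 - a := by
      rw [div_le_iff₀ (by positivity), hts]
      field_simp
      linarith
    have hc := probReal_compl_eq_one_sub (μ := binomial m p)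
      (s := Set.Iic ⌊(m : ℝ) * p + t⌋₊) (by measurability)
    have hsub : (binomial m p).real (Set.Iic ⌊(m : ℝ) * p + t⌋₊)ᶜ ≤
        (binomial m p).real {k : ℕ | (m : ℝ) * p + t ≤ k} := by
      refine measureReal_mono (fun k hk => ?_)
      simp only [Set.mem_compl_iff, Set.mem_Iic, not_le] at hk
      exact ((Nat.floor_lt (by positivity)).1 hk).le
    change a ≤ _
    linarith
  calc (binomialQuantile a p m : ℝ) ≤ (⌊(m : ℝ) * p + t⌋₊ : ℝ) := by exact_mod_cast hle
    _ ≤ _ := Nat.floor_le (by positivity)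

/-- The law is a point mass at `m`. This is what makes `l = 1` feasible for the adaptive estimator.
-/
lemma binomialQuantile_one {a : ℝ} (ha0 : 0 < a) (ha1 : a ≤ 1) (m : ℕ) :
    binomialQuantile a 1 m = m := by
  have hm : (binomial m 1).real {m} = 1 := by simp
  refine le_antisymm (Nat.sInf_le ?_) (le_csInf ⟨m, ?_⟩ fun k hk => ?_)
  iterate 2
    exact ha1.trans (hm ▸ measureReal_mono (by simp))
  by_contra! hkm
  have hdisj : (binomial m 1).real (Set.Iic k) ≤ (binomial m 1).real {m}ᶜ :=
    measureReal_mono fun j hj => by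
      have : j ≤ k := hj
      simp only [Set.mem_compl_iff, Set.mem_singleton_iff]
      omega
  rw [probReal_compl_eq_one_sub (by measurability), hm] at hdisj
  have : a ≤ (binomial m 1).real (Set.Iic k) := hk
  linarith

/-! ### The confidence band -/

/-- With `u = log log k` the factor is of order `√u`, hence eventually at most `u ≤ log k ≤ k ^ δ`.
-/
lemma eventually_bandFactor_le_rpow (x : ℝ) {δ : ℝ} (hδ : 0 < δ) :
    ∀ᶠ k : ℝ in atTop, bandFactor x k ≤ k ^ δ := by
  have hu : ∀ᶠ u : ℝ in atTop, Real.sqrt (2 * u)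
      + (Real.log u - Real.log Real.pi + 2 * x) / (2 * Real.sqrt (2 * u)) ≤ u := by
    have hl := (Real.isLittleO_log_id_atTop.bound (show (0 : ℝ) < 1 / 8 by norm_num))
    filter_upwards [hl, eventually_ge_atTop (8 : ℝ),
      eventually_ge_atTop (8 * |(- Real.log Real.pi + 2 * x)|)] with u h1 h8 hC
    have h1' : Real.log u ≤ 1 / 8 * u := by
      have := (le_abs_self _).trans h1
      simpa [abs_of_pos (show (0 : ℝ) < u by linarith)] using this
    have hs4 : 4 ≤ Real.sqrt (2 * u) := Real.le_sqrt_of_sq_le (by linarith)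
    have hsq : Real.sqrt (2 * u) ^ 2 = 2 * u := Real.sq_sqrt (by linarith)
    have hs : Real.sqrt (2 * u) ≤ u / 2 := by nlinarith
    have hd : (Real.log u - Real.log Real.pi + 2 * x) / (2 * Real.sqrt (2 * u)) ≤ u / 4 := by
      rw [div_le_iff₀ (by linarith)]
      have := le_abs_self (- Real.log Real.pi + 2 * x)
      nlinarith
    linarith
  have hlog := (isLittleO_log_rpow_atTop hδ).bound one_pos
  filter_upwards [(Real.tendsto_log_atTop.comp Real.tendsto_log_atTop).eventually hu, hlog,
    Real.tendsto_log_atTop.eventually_ge_atTop 1, eventually_ge_atTop (0 : ℝ)] with k h1 h2 h3 h4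
  refine h1.trans ?_
  have h5 : Real.log (Real.log k) ≤ Real.log k :=
    (Real.log_le_sub_one_of_pos (by linarith)).trans (by linarith)
  have h6 : Real.log k ≤ k ^ δ := by
    have := (le_abs_self _).trans h2
    simpa [abs_of_nonneg (Real.rpow_nonneg h4 δ)] using this
  exact h5.trans h6

lemma hyperSd_le_sqrt {z m n : ℝ} (hm : 0 ≤ m) (hn : 0 < n) (hz : 1 ≤ z) (hzm : z ≤ m) :
    hyperSd z m n ≤ Real.sqrt z := by
  refine Real.sqrt_le_sqrt ?_
  have h1 : m / (m + n) ≤ 1 := by rw [div_le_one (by linarith)]; linarith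
  have h2 : n / (m + n) ≤ 1 := by rw [div_le_one (by linarith)]; linarith
  have h3 : (m + n - z) / (m + n - 1) ≤ 1 := by rw [div_le_one (by linarith)]; linarith
  have h4 : 0 ≤ (m + n - z) / (m + n - 1) := div_nonneg (by linarith) (by linarith)
  have h5 : 0 ≤ n / (m + n) := by positivity
  calc _ ≤ 1 * 1 * 1 * z := by gcongr
    _ = z := by ring

/-- At `z` beyond the binomial quantile, the bounding function lies below `z` as soon as the excess
of `z` over the quantile dominates the squared width of the confidence band. -/
lemma boundingFunction_lt_self {α x : ℝ} {m n z : ℕ} {l : unitInterval} {κ B : ℝ}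
    (hqz : binomialQuantile (1 - α / 3) l m < z) (hzm : z ≤ m)
    (hqn : binomialQuantile (1 - α / 3) l n < n)
    (hκ : 0 < κ) (hB : 0 ≤ B)
    (hκle : κ * (m + n) ≤ (n - binomialQuantile (1 - α / 3) l n : ℝ))
    (hband : bandFactor x ((m - binomialQuantile (1 - α / 3) l m : ℕ) : ℝ) ≤ B)
    (hD : B ^ 2 < κ ^ 2 * (z - binomialQuantile (1 - α / 3) l m : ℝ)) :
    boundingFunction α x m n z l < z := by
  unfold boundingFunction
  set q := binomialQuantile (1 - α / 3) l m
  set qn := binomialQuantile (1 - α / 3) l n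
  have hqm : q ≤ m := by omega
  dsimp only
  rw [if_neg (by omega), if_neg (by omega)]
  have hnl : 0 < ((n - qn : ℕ) : ℝ) := by exact_mod_cast (by omega : 0 < n - qn)
  have hz1 : (1 : ℝ) ≤ (z : ℝ) - q := by
    have : (q : ℝ) + 1 ≤ z := by exact_mod_cast hqz
    linarith
  have hzml : (z : ℝ) - q ≤ ((m - q : ℕ) : ℝ) := by
    rw [Nat.cast_sub hqm]
    have : (z : ℝ) ≤ m := by exact_mod_cast hzm
    linarith
  have hw := hyperSd_le_sqrt (n := ((n - qn : ℕ) : ℝ)) (Nat.cast_nonneg _) hnl hz1 hzml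
  have hml : (0 : ℝ) ≤ ((m - q : ℕ) : ℝ) := Nat.cast_nonneg _
  have hml' : ((m - q : ℕ) : ℝ) ≤ m := by exact_mod_cast Nat.sub_le _ _
  have hnl' : ((n - qn : ℕ) : ℝ) ≤ n := by exact_mod_cast Nat.sub_le _ _
  rw [← Nat.cast_sub hqn.le] at hκle
  set ml : ℝ := ((m - q : ℕ) : ℝ)
  set nl : ℝ := ((n - qn : ℕ) : ℝ)
  set D : ℝ := (z : ℝ) - q
  have hbw : bandFactor x ml * hyperSd D ml nl ≤ B * Real.sqrt D :=
    mul_le_mul hband hw (Real.sqrt_nonneg _) hB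
  -- The complementary fraction is `nl / (ml + nl)`, with `nl ≥ κ (m + n)` and `ml + nl ≤ m + n`.
  have hfrac : ml / (ml + nl) ≤ 1 - κ := by
    rw [div_le_iff₀ (by linarith)]
    nlinarith
  have hsD : 0 < Real.sqrt D := Real.sqrt_pos.2 (by linarith)
  have hDs : Real.sqrt D ^ 2 = D := Real.sq_sqrt (by linarith)
  have hBκ : B < κ * Real.sqrt D := by
    refine lt_of_pow_lt_pow_left₀ 2 (by positivity) ?_
    rw [mul_pow, hDs]
    exact hD
  have h1 : D * (ml / (ml + nl)) ≤ D * (1 - κ) :=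
    mul_le_mul_of_nonneg_left hfrac (by linarith)
  have h2 : B * Real.sqrt D < κ * D := by nlinarith
  have h3 : (z : ℝ) = q + D := by simp [D]
  linarith

/-! ### Counts along the arranged sample -/

lemma countFirst_le {m n : ℕ} (e : Fin (m + n) ≃ Fin m ⊕ Fin n) (z : ℕ) :
    countFirst e z ≤ z ∧ countFirst e z ≤ m := by
  constructor
  · calc countFirst e z ≤ (Finset.range z).card :=
        Finset.card_le_card_of_injOn (fun i => (i : ℕ))
          (fun i hi => by simp at hi ⊢; exact hi.1) (fun i _ j _ h => Fin.ext h)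
      _ = z := Finset.card_range z
  · calc countFirst e z ≤ ((Finset.univ : Finset (Fin m)).map Function.Embedding.inl).card :=
        Finset.card_le_card_of_injOn (t := (Finset.univ : Finset (Fin m)).map
            (Function.Embedding.inl : Fin m ↪ Fin m ⊕ Fin n)) e
          (fun i hi => by
            simp only [Finset.coe_filter, Finset.mem_univ, true_and, Set.mem_ofPred_eq] at hi
            obtain ⟨a, ha⟩ := Sum.isLeft_iff.1 hi.2
            simp [ha]) e.injective.injOn
      _ = m := by simp

/-- If the observations `≤ 0` are all of the first kind, they come first in the arrangement. -/
lemma le_countFirst {m n : ℕ} (e : Fin (m + n) ≃ Fin m ⊕ Fin n) (r : Fin m ⊕ Fin n → ℝ)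
    (hmono : Monotone fun i => r (e i)) (hr : ∀ j, 0 < r (Sum.inr j)) :
    (Finset.univ.filter fun i : Fin m => r (Sum.inl i) ≤ 0).card ≤
      countFirst e (Finset.univ.filter fun i : Fin m => r (Sum.inl i) ≤ 0).card := by
  set T := (Finset.univ.filter fun i : Fin m => r (Sum.inl i) ≤ 0).card with hT
  set B := Finset.univ.filter fun i : Fin (m + n) => r (e i) ≤ 0 with hB
  have hBT : T ≤ B.card := by
    refine Finset.card_le_card_of_injOn (fun i => e.symm (Sum.inl i)) (fun i hi => ?_)
      (fun i _ j _ h => Sum.inl_injective (e.symm.injective h))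
    simpa [hB] using hi
  -- A positive value at position `i` would, by monotonicity, confine `B` to the `i < T` earlier
  -- positions, contradicting `T ≤ B.card`.
  have hmem : ∀ i : Fin (m + n), (i : ℕ) < T → i ∈ B := by
    intro i hi
    by_contra hiB
    have hsub : B ⊆ Finset.Iio i := fun j hj => by
      rw [Finset.mem_Iio]
      by_contra! hij
      have h1 : r (e i) ≤ r (e j) := hmono hij
      have h2 : r (e j) ≤ 0 := by simpa [hB] using hj
      exact hiB (by simpa [hB] using h1.trans h2)
    have := Finset.card_le_card hsub
    rw [Fin.card_Iio] at this
    omega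
  have hTm : T ≤ m := (Finset.card_le_univ _).trans (by simp)
  calc T = (Finset.univ : Finset (Fin T)).card := by simp
    _ ≤ _ := Finset.card_le_card_of_injOn (fun i => Fin.castLE (by omega) i) (fun i _ => by
        have h1 := hmem (Fin.castLE (by omega) i) i.2
        simp only [Finset.coe_filter, Finset.mem_univ, true_and, Set.mem_ofPred_eq,
          Fin.val_castLE, i.2]
        rw [hB, Finset.mem_filter] at h1
        rcases h : e (Fin.castLE (by omega) i) with a | b
        · rfl
        · rw [h] at h1
          exact absurd h1.2 (not_le.2 (hr b))) (fun i _ j _ h => Fin.castLE_injective _ h)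

/-! ### Concentration of the number of observations in a set -/

section Sampling

variable {X : Type*}

open Classical in
/-- The number of the observations `x_1, …, x_k` in `A`. -/
noncomputable def countIn {k : ℕ} (A : Set X) (x : Fin k → X) : ℕ :=
  (Finset.univ.filter fun i => x i ∈ A).card

lemma cast_countIn {k : ℕ} (A : Set X) (x : Fin k → X) :
    (countIn A x : ℝ) = ∑ i, A.indicator (1 : X → ℝ) (x i) := by
  classical
  rw [countIn, Finset.card_filter]
  push_cast
  exact Finset.sum_congr rfl fun i _ => by by_cases h : x i ∈ A <;> simp [h]

lemma countIn_setOf_eq_card {k : ℕ} (ρ : X → ℝ) (u : Fin k → X) :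
    countIn {z | ρ z ≤ 0} u = (Finset.univ.filter fun i => ρ (u i) ≤ 0).card := by
  unfold countIn
  congr

variable [MeasurableSpace X]

/-- Chebyshev for a sum of independent indicators, whose variance is at most its mean; hence a
relative error controlled by the mean alone. -/
lemma pi_real_countIn_lower_tail_le (P : Measure X) [IsProbabilityMeasure P] (m : ℕ) {A : Set X}
    (hA : MeasurableSet A) {η : ℝ} (hη : 0 < η) (hpos : 0 < m * P.real A) :
    (Measure.pi fun _ : Fin m => P).real
      {x | (countIn A x : ℝ) ≤ (1 - η) * (m * P.real A)} ≤ 1 / (η ^ 2 * (m * P.real A)) := by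
  set f : X → ℝ := A.indicator 1 with hf
  have hfm : Measurable f := measurable_one.indicator hA
  have hf01 : ∀ x, f x ∈ Set.Icc (0 : ℝ) 1 := fun x => by
    by_cases h : x ∈ A <;> simp [hf, h]
  have hfL : MemLp f 2 P :=
    memLp_of_bounded (Eventually.of_forall hf01) hfm.aestronglyMeasurable 2
  have hfi : ∫ x, f x ∂P = P.real A := by rw [hf, integral_indicator_one hA]
  have hvar : Var[f; P] ≤ P.real A := by
    have h1 := variance_le_sub_mul_sub (Eventually.of_forall hf01) hfm.aemeasurable (μ := P)
    rw [hfi] at h1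
    nlinarith [sq_nonneg (P.real A)]
  set S : (Fin m → X) → ℝ := ∑ i, fun ω => f (ω i) with hS
  have hSvar : Var[S; Measure.pi fun _ : Fin m => P] ≤ m * P.real A := by
    rw [hS, variance_sum_pi (X := fun _ => f) (fun _ => hfL)]
    simpa using mul_le_mul_of_nonneg_left hvar (Nat.cast_nonneg m)
  have hcomp : ∀ i : Fin m, MemLp (fun ω : Fin m → X => f (ω i)) 2 (Measure.pi fun _ => P) :=
    fun i => hfL.comp_measurePreserving (measurePreserving_eval (fun _ : Fin m => P) i)
  have hSL : MemLp S 2 (Measure.pi fun _ : Fin m => P) :=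
    memLp_finsetSum' _ fun i _ => hcomp i
  have hSint : ∫ ω, S ω ∂(Measure.pi fun _ : Fin m => P) = m * P.real A := by
    simp only [hS, Finset.sum_apply]
    rw [integral_finsetSum _ fun i _ => (hcomp i).integrable (by norm_num)]
    have : ∀ i : Fin m, ∫ ω : Fin m → X, f (ω i) ∂(Measure.pi fun _ => P) = P.real A := fun i => by
      rw [← hfi]
      exact integral_comp_eval (μ := fun _ : Fin m => P) (f := f) hfm.aestronglyMeasurable
    simp [this]
  have hScount : ∀ ω, S ω = countIn A ω := fun ω => by
    rw [cast_countIn, hS, hf, Finset.sum_apply]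
  have hcheb := meas_ge_le_variance_div_sq hSL (c := η * (m * P.real A)) (by positivity)
  rw [hSint] at hcheb
  have hcheb' := ENNReal.toReal_le_of_le_ofReal (by positivity) (hcheb.trans
    (ENNReal.ofReal_le_ofReal (div_le_div_of_nonneg_right hSvar (sq_nonneg _))))
  refine ((measureReal_mono fun ω hω => ?_).trans hcheb').trans (le_of_eq ?_)
  · have h1 : (countIn A ω : ℝ) ≤ (1 - η) * (m * P.real A) := hω
    rw [← hScount] at h1
    change η * (m * P.real A) ≤ |S ω - m * P.real A|
    rw [abs_sub_comm]
    exact le_trans (by linarith) (le_abs_self _)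
  · field_simp

lemma measurable_countIn {k : ℕ} {A : Set X} (hA : MeasurableSet A) :
    Measurable fun x : Fin k → X => (countIn A x : ℝ) := by
  simp only [cast_countIn]
  exact Finset.measurable_sum _ fun i _ =>
    (measurable_one.indicator hA).comp (measurable_pi_apply i)

instance (P Q : ProbabilityMeasure X) (m n : ℕ) : IsProbabilityMeasure (sampleLaw P Q m n) := by
  unfold sampleLaw
  infer_instance

/-- If `A` is a `Q`-null set, then with large probability the first sample has about `m P(A)` points
in `A` and the second one has none. -/
lemma le_sampleLaw_real (P Q : ProbabilityMeasure X) (m n : ℕ) {A : Set X}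
    (hA : MeasurableSet A) (hQ : (Q : Measure X) A = 0) {η : ℝ} (hη : 0 < η)
    (hpos : 0 < m * (P : Measure X).real A)
    {E : Set ((Fin m → X) × (Fin n → X))}
    (hE : ∀ x y, (1 - η) * (m * (P : Measure X).real A) < countIn A x → (∀ j, y j ∉ A) →
      (x, y) ∈ E) :
    1 - 1 / (η ^ 2 * (m * (P : Measure X).real A)) ≤ (sampleLaw P Q m n).real E := by
  set U : Set (Fin m → X) := {x | (countIn A x : ℝ) ≤ (1 - η) * (m * (P : Measure X).real A)}
  have hU : MeasurableSet U := measurableSet_le (measurable_countIn hA) measurable_const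
  set V : Set (Fin n → X) := Set.univ.pi fun _ => Aᶜ
  have hV : (Measure.pi fun _ : Fin n => (Q : Measure X)) V = 1 := by
    rw [Measure.pi_pi]
    simp [prob_compl_eq_one_sub hA, hQ]
  have hsub : Uᶜ ×ˢ V ⊆ E := by
    rintro ⟨x, y⟩ ⟨hx, hy⟩
    exact hE x y (not_le.1 hx) fun j => hy j (Set.mem_univ j)
  refine le_trans ?_ (measureReal_mono hsub)
  have hprod : (sampleLaw P Q m n).real (Uᶜ ×ˢ V) =
      (Measure.pi fun _ : Fin m => (P : Measure X)).real Uᶜ := by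
    rw [sampleLaw, measureReal_def, Measure.prod_prod, hV, mul_one, measureReal_def]
  rw [hprod, probReal_compl_eq_one_sub hU]
  linarith [pi_real_countIn_lower_tail_le (P : Measure X) m hA hη hpos]

/-! ### The Bayes projection -/

lemma bayesProjection_nonneg (P Q : ProbabilityMeasure X) (z : X) : 0 ≤ bayesProjection P Q z := by
  unfold bayesProjection
  positivity

lemma measurable_bayesProjection (P Q : ProbabilityMeasure X) :
    Measurable (bayesProjection P Q) := by
  unfold bayesProjection
  fun_prop

lemma bayesProjection_le_zero_iff (P Q : ProbabilityMeasure X) (z : X) :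
    bayesProjection P Q z ≤ 0 ↔
      ((Q : Measure X).rnDeriv ((P : Measure X) + Q) z).toReal = 0 := by
  rw [(bayesProjection_nonneg P Q z).ge_iff_eq']
  unfold bayesProjection
  dsimp only
  have hf : 0 ≤ ((P : Measure X).rnDeriv ((P : Measure X) + Q) z).toReal := ENNReal.toReal_nonneg
  have hg : 0 ≤ ((Q : Measure X).rnDeriv ((P : Measure X) + Q) z).toReal := ENNReal.toReal_nonneg
  rw [div_eq_zero_iff]
  constructor
  · rintro (h | h)
    · exact h
    -- A vanishing denominator is the `0 / 0 = 0` case; it also forces `g = 0`, as both densities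
    -- are nonnegative.
    · linarith
  · exact Or.inl

lemma measurableSet_bayesProjection_le_zero (P Q : ProbabilityMeasure X) :
    MeasurableSet {z | bayesProjection P Q z ≤ 0} :=
  measurableSet_le (measurable_bayesProjection P Q) measurable_const

/-- The `Q`-mass is the integral of the density `g`, which vanishes on this region. -/
lemma measure_right_bayesProjection_le_zero (P Q : ProbabilityMeasure X) :
    (Q : Measure X) {z | bayesProjection P Q z ≤ 0} = 0 := by
  have hac : (Q : Measure X) ≪ (P : Measure X) + Q := Measure.absolutelyContinuous_of_le
    (Measure.le_add_left le_rfl)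
  rw [← Measure.setLIntegral_rnDeriv hac, lintegral_eq_zero_iff (Measure.measurable_rnDeriv _ _)]
  rw [EventuallyEq, ae_restrict_iff' (measurableSet_bayesProjection_le_zero P Q)]
  filter_upwards [Measure.rnDeriv_lt_top (Q : Measure X) ((P : Measure X) + Q)] with z hz hz0
  have := (bayesProjection_le_zero_iff P Q z).1 hz0
  rw [ENNReal.toReal_eq_zero_iff] at this
  exact this.resolve_right hz.ne

/-- The projection vanishes almost surely on the sets that are null under `Q`. -/
lemma measureReal_le_bayesProjection_le_zero (P Q : ProbabilityMeasure X) {s : Set X}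
    (hs : MeasurableSet s) (hQ : (Q : Measure X) s = 0) :
    (P : Measure X).real s ≤ (P : Measure X).real {z | bayesProjection P Q z ≤ 0} := by
  have hacQ : (Q : Measure X) ≪ (P : Measure X) + Q := Measure.absolutelyContinuous_of_le
    (Measure.le_add_left le_rfl)
  have hacP : (P : Measure X) ≪ (P : Measure X) + Q := Measure.absolutelyContinuous_of_le
    (Measure.le_add_right le_rfl)
  rw [← Measure.setLIntegral_rnDeriv hacQ, lintegral_eq_zero_iff (Measure.measurable_rnDeriv _ _),
    EventuallyEq, ae_restrict_iff' hs] at hQ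
  refine ENNReal.toReal_mono (measure_ne_top _ _) (measure_mono_ae ?_)
  filter_upwards [hacP.ae_le hQ] with z hz hzs
  refine (bayesProjection_le_zero_iff P Q z).2 ?_
  rw [hz hzs]
  simp

lemma abs_sub_le_tvDist (P Q : ProbabilityMeasure X) {A : Set X} (hA : MeasurableSet A) :
    |(P : Measure X).real A - (Q : Measure X).real A| ≤ tvDist P Q := by
  refine le_ciSup (f := fun A : {A : Set X // MeasurableSet A} =>
    |(P : Measure X).real A.1 - (Q : Measure X).real A.1|) ⟨1, ?_⟩ ⟨A, hA⟩
  rintro _ ⟨B, rfl⟩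
  dsimp only
  rw [abs_le]
  constructor <;>
    linarith [measureReal_nonneg (μ := (P : Measure X)) (s := B.1),
      measureReal_nonneg (μ := (Q : Measure X)) (s := B.1),
      measureReal_le_one (μ := (P : Measure X)) (s := B.1),
      measureReal_le_one (μ := (Q : Measure X)) (s := B.1)]

lemma measureReal_bayesProjection_le_tvDist (P Q : ProbabilityMeasure X) :
    (P : Measure X).real {z | bayesProjection P Q z ≤ 0} ≤ tvDist P Q := by
  have h := abs_sub_le_tvDist P Q (measurableSet_bayesProjection_le_zero P Q)
  have h0 : (Q : Measure X).real {z | bayesProjection P Q z ≤ 0} = 0 := by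
    rw [measureReal_def, measure_right_bayesProjection_le_zero]; rfl
  rw [h0, sub_zero] at h
  exact (le_abs_self _).trans h

/-! ### The mixture model -/

/-- In the mixture model the region where the projection vanishes carries the total variation
distance up to `2 p₂ - 1`. -/
lemma tvDist_le_of_mixture {C₁ C₂ P₀ Q₀ P Q : ProbabilityMeasure X} {p₁ p₂ : ℝ}
    (hdisj : DisjointSupports ![C₁, C₂, P₀, Q₀]) (hp₁ : p₁ ∈ Set.Ioo (0 : ℝ) 1)
    (hp₂ : p₂ ∈ Set.Ioo (1 / 2 : ℝ) 1)
    (hP : (P : Measure X) = ENNReal.ofReal p₁ • (C₁ : Measure X)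
        + ENNReal.ofReal ((1 - p₁) * p₂) • (P₀ : Measure X)
        + ENNReal.ofReal ((1 - p₁) * (1 - p₂)) • (Q₀ : Measure X))
    (hQ : (Q : Measure X) = ENNReal.ofReal p₁ • (C₂ : Measure X)
        + ENNReal.ofReal ((1 - p₁) * p₂) • (Q₀ : Measure X)
        + ENNReal.ofReal ((1 - p₁) * (1 - p₂)) • (P₀ : Measure X)) :
    tvDist P Q ≤ (P : Measure X).real {z | bayesProjection P Q z ≤ 0} + (2 * p₂ - 1) := by
  obtain ⟨h0, h1⟩ := hp₁
  obtain ⟨h2, h3⟩ := hp₂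
  have hPr : ∀ A, (P : Measure X).real A = p₁ * (C₁ : Measure X).real A
      + (1 - p₁) * p₂ * (P₀ : Measure X).real A + (1 - p₁) * (1 - p₂) * (Q₀ : Measure X).real A := by
    intro A
    have a1 : 0 ≤ p₁ := h0.le
    have a2 : 0 ≤ (1 - p₁) * p₂ := mul_nonneg (by linarith) (by linarith)
    have a3 : 0 ≤ (1 - p₁) * (1 - p₂) := mul_nonneg (by linarith) (by linarith)
    simp only [hP, measureReal_def, Measure.add_apply, Measure.smul_apply, smul_eq_mul]
    rw [ENNReal.toReal_add (by finiteness) (by finiteness),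
      ENNReal.toReal_add (by finiteness) (by finiteness)]
    simp only [ENNReal.toReal_mul, ENNReal.toReal_ofReal a1, ENNReal.toReal_ofReal a2,
      ENNReal.toReal_ofReal a3]
  have hQr : ∀ A, (Q : Measure X).real A = p₁ * (C₂ : Measure X).real A
      + (1 - p₁) * p₂ * (Q₀ : Measure X).real A + (1 - p₁) * (1 - p₂) * (P₀ : Measure X).real A := by
    intro A
    have a1 : 0 ≤ p₁ := h0.le
    have a2 : 0 ≤ (1 - p₁) * p₂ := mul_nonneg (by linarith) (by linarith)
    have a3 : 0 ≤ (1 - p₁) * (1 - p₂) := mul_nonneg (by linarith) (by linarith)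
    simp only [hQ, measureReal_def, Measure.add_apply, Measure.smul_apply, smul_eq_mul]
    rw [ENNReal.toReal_add (by finiteness) (by finiteness),
      ENNReal.toReal_add (by finiteness) (by finiteness)]
    simp only [ENNReal.toReal_mul, ENNReal.toReal_ofReal a1, ENNReal.toReal_ofReal a2,
      ENNReal.toReal_ofReal a3]
  -- The set `s 0` carries `C₁` and is null for the other three components, hence for `Q`; this
  -- gives `p₁` as a lower bound for the mass of the zero region.
  obtain ⟨s, hsm, hsd, hs⟩ := hdisj
  have hnull : ∀ i : Fin 4, i ≠ 0 → ((![C₁, C₂, P₀, Q₀] i : ProbabilityMeasure X) : Measure X)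
      (s 0) = 0 := fun i hi =>
    measure_mono_null (Set.disjoint_left.1 (hsd hi.symm)) (hs i)
  have n1 : (C₂ : Measure X) (s 0) = 0 := hnull 1 (by decide)
  have n2 : (P₀ : Measure X) (s 0) = 0 := hnull 2 (by decide)
  have n3 : (Q₀ : Measure X) (s 0) = 0 := hnull 3 (by decide)
  have n0 : (C₁ : Measure X) (s 0) = 1 := (prob_compl_eq_zero_iff (hsm 0)).1 (hs 0)
  have hQ0 : (Q : Measure X) (s 0) = 0 := by simp [hQ, n1, n2, n3]
  have hP0 : p₁ ≤ (P : Measure X).real (s 0) := by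
    rw [hPr]
    simp [measureReal_def, n0, n2, n3]
  have hkey := hP0.trans (measureReal_le_bayesProjection_le_zero P Q (hsm 0) hQ0)
  refine le_trans ?_ (add_le_add_left hkey _)
  have : Nonempty {A : Set X // MeasurableSet A} := ⟨⟨∅, MeasurableSet.empty⟩⟩
  refine ciSup_le fun A => ?_
  rw [hPr, hQr]
  have hb : ∀ μ ν : ProbabilityMeasure X,
      |(μ : Measure X).real A.1 - (ν : Measure X).real A.1| ≤ 1 := fun μ ν => by
    rw [abs_le]
    constructor <;>
      linarith [measureReal_nonneg (μ := (μ : Measure X)) (s := A.1),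
        measureReal_nonneg (μ := (ν : Measure X)) (s := A.1),
        measureReal_le_one (μ := (μ : Measure X)) (s := A.1),
        measureReal_le_one (μ := (ν : Measure X)) (s := A.1)]
  have hC := hb C₁ C₂
  have hPQ := hb P₀ Q₀
  -- The mixing of `P₀` and `Q₀` cancels except for the imbalance `p₂ - (1 - p₂)`.
  have heq : p₁ * (C₁ : Measure X).real A.1
      + (1 - p₁) * p₂ * (P₀ : Measure X).real A.1 + (1 - p₁) * (1 - p₂) * (Q₀ : Measure X).real A.1
      - (p₁ * (C₂ : Measure X).real A.1
      + (1 - p₁) * p₂ * (Q₀ : Measure X).real A.1 + (1 - p₁) * (1 - p₂) * (P₀ : Measure X).real A.1)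
      = p₁ * ((C₁ : Measure X).real A.1 - (C₂ : Measure X).real A.1)
        + (1 - p₁) * (2 * p₂ - 1) * ((P₀ : Measure X).real A.1 - (Q₀ : Measure X).real A.1) := by
    ring
  rw [heq]
  refine (abs_add_le _ _).trans ?_
  rw [abs_mul, abs_mul, abs_of_pos h0, abs_of_nonneg (mul_nonneg (by linarith) (by linarith) :
    0 ≤ (1 - p₁) * (2 * p₂ - 1))]
  have e1 : p₁ * |(C₁ : Measure X).real A.1 - (C₂ : Measure X).real A.1| ≤ p₁ * 1 := by gcongr
  have e2 : (1 - p₁) * (2 * p₂ - 1) * |(P₀ : Measure X).real A.1 - (Q₀ : Measure X).real A.1| ≤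
      1 * (2 * p₂ - 1) * 1 := by
    have : 0 ≤ 2 * p₂ - 1 := by linarith
    gcongr
    linarith
  linarith

end Sampling

/-! ### Detection -/

section Detection

variable {X : Type*} [MeasurableSpace X]

/-- Removes the probability from the problem: only a measurable event inside the detection set is
needed, so the estimator itself need not be measurable. -/
lemma detects_of_eventually (m n : ℕ → ℕ) (A : Alternative X) (est : ℕ → Estimator X) {ε η : ℝ}
    (hη : 0 < η)
    (hL : Tendsto (fun N => (m N : ℝ) *
      ((A N).1 : Measure X).real {z | bayesProjection (A N).1 (A N).2 z ≤ 0}) atTop atTop)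
    (hE : ∀ᶠ N in atTop, ∀ (x : Fin (m N) → X) (y : Fin (n N) → X),
      (1 - η) * (m N * ((A N).1 : Measure X).real {z | bayesProjection (A N).1 (A N).2 z ≤ 0}) <
        countIn {z | bayesProjection (A N).1 (A N).2 z ≤ 0} x →
      (∀ j, 0 < bayesProjection (A N).1 (A N).2 (y j)) →
      (1 - ε) * signal A N < est N (A N).1 (A N).2 (m N) (n N) x y) :
    Detects m n A est ε := by
  have hlim : Tendsto (fun N => 1 - 1 / (η ^ 2 * ((m N : ℝ) *
      ((A N).1 : Measure X).real {z | bayesProjection (A N).1 (A N).2 z ≤ 0}))) atTop (𝓝 1) := by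
    have h := (hL.const_mul_atTop (show 0 < η ^ 2 by positivity)).inv_tendsto_atTop
    simpa [one_div] using h.const_sub 1
  refine tendsto_of_tendsto_of_tendsto_of_le_of_le' hlim tendsto_const_nhds ?_
    (Eventually.of_forall fun N => measureReal_le_one)
  filter_upwards [hE, hL.eventually_gt_atTop 0] with N h hpos
  refine le_sampleLaw_real _ _ _ _ (measurableSet_bayesProjection_le_zero _ _)
    (measure_right_bayesProjection_le_zero _ _) hη hpos fun x y hx hy => h x y hx fun j => ?_
  simpa using hy j

lemma rate_eq_neg_one {m n : ℕ → ℕ} {𝒜 : Set (Alternative X)} {est : Estimator X} {ε : ℝ}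
    (h : ∀ γ ∈ Set.Ioo (-1 : ℝ) 0, ∀ A ∈ 𝒜,
      signal A =Θ[atTop] (fun N : ℕ => (N : ℝ) ^ γ) → Detects m n A (fun _ => est) ε) :
    rate m n 𝒜 est ε = -1 :=
  IsLeast.csInf_eq ⟨⟨by norm_num, h⟩, fun _ hγ => hγ.1.1⟩

lemma oracleRate_eq_neg_one {m n : ℕ → ℕ} {𝒜 : Set (Alternative X)} {α ε : ℝ}
    (h : ∀ γ ∈ Set.Ioo (-1 : ℝ) 0, ∀ A ∈ 𝒜,
      signal A =Θ[atTop] (fun N : ℕ => (N : ℝ) ^ γ) →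
        Detects m n A (fun _ => cutoffEstimator X α 0) ε) :
    oracleRate m n 𝒜 α ε = -1 :=
  IsLeast.csInf_eq ⟨⟨by norm_num, fun γ hγ => ⟨fun _ => 0, by simp, h γ hγ⟩⟩, fun _ hγ => hγ.1.1⟩

/-! ### Orders of magnitude of the sample sizes and the signal -/

lemma eventually_mul_le_of_tendsto_div {k : ℕ → ℕ} {c b : ℝ} (hbc : b < c)
    (hk : Tendsto (fun N : ℕ => (k N : ℝ) / N) atTop (𝓝 c)) :
    ∀ᶠ N : ℕ in atTop, b * N ≤ k N := by
  filter_upwards [hk.eventually_const_lt hbc, eventually_gt_atTop 0] with N h hN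
  have hN' : (0 : ℝ) < N := by exact_mod_cast hN
  exact ((lt_div_iff₀ hN').1 h).le

lemma eventually_mul_rpow_le {s : ℕ → ℝ} {γ : ℝ} (hs0 : ∀ N, 0 ≤ s N)
    (hs : s =Θ[atTop] (fun N : ℕ => (N : ℝ) ^ γ)) :
    ∃ K > 0, ∀ᶠ N : ℕ in atTop, K * (N : ℝ) ^ γ ≤ s N := by
  obtain ⟨C, hC, h⟩ := hs.2.exists_pos
  refine ⟨C⁻¹, by positivity, ?_⟩
  filter_upwards [h.bound] with N hN
  rw [Real.norm_of_nonneg (by positivity), Real.norm_of_nonneg (hs0 N)] at hN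
  rw [inv_mul_le_iff₀ hC]
  exact hN

lemma tendsto_zero_of_isTheta_rpow {s : ℕ → ℝ} {γ : ℝ} (hγ : γ < 0)
    (hs : s =Θ[atTop] (fun N : ℕ => (N : ℝ) ^ γ)) : Tendsto s atTop (𝓝 0) := by
  refine hs.1.trans_tendsto ?_
  have := (tendsto_rpow_neg_atTop (neg_pos.2 hγ)).comp tendsto_natCast_atTop_atTop
  simpa [Function.comp_def] using this

lemma signal_nonneg (A : Alternative X) (N : ℕ) : 0 ≤ signal A N :=
  (measureReal_nonneg).trans (measureReal_bayesProjection_le_tvDist _ _)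

variable {m n : ℕ → ℕ} {c : ℝ} {C₁ C₂ P₀ Q₀ : ℕ → ProbabilityMeasure X} {p₂ : ℕ → ℝ}
  {A : Alternative X} {γ ε α x : ℝ}

lemma exists_mul_rpow_le_mul_signal (hc : 0 < c)
    (hm : Tendsto (fun N : ℕ => (m N : ℝ) / N) atTop (𝓝 c))
    (hs : signal A =Θ[atTop] (fun N : ℕ => (N : ℝ) ^ γ)) :
    ∃ K > 0, ∀ᶠ N : ℕ in atTop, K * (N : ℝ) ^ (1 + γ) ≤ m N * signal A N := by
  obtain ⟨K, hK, h⟩ := eventually_mul_rpow_le (signal_nonneg A) hs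
  refine ⟨c / 2 * K, by positivity, ?_⟩
  filter_upwards [h, eventually_mul_le_of_tendsto_div (half_lt_self hc) hm,
    eventually_gt_atTop 0] with N h1 h2 hN
  have hN' : (0 : ℝ) < N := by exact_mod_cast hN
  calc c / 2 * K * (N : ℝ) ^ (1 + γ) = (c / 2 * N) * (K * (N : ℝ) ^ γ) := by
        rw [Real.rpow_add hN', Real.rpow_one]; ring
    _ ≤ _ := by gcongr

lemma tendsto_mul_signal (hc : 0 < c)
    (hm : Tendsto (fun N : ℕ => (m N : ℝ) / N) atTop (𝓝 c)) (hγ : -1 < γ)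
    (hs : signal A =Θ[atTop] (fun N : ℕ => (N : ℝ) ^ γ)) :
    Tendsto (fun N => (m N : ℝ) * signal A N) atTop atTop := by
  obtain ⟨K, hK, h⟩ := exists_mul_rpow_le_mul_signal hc hm hs
  refine tendsto_atTop_mono' _ h (Tendsto.const_mul_atTop hK ?_)
  exact (tendsto_rpow_atTop (by linarith)).comp tendsto_natCast_atTop_atTop

lemma eventually_signal_pos (hs : signal A =Θ[atTop] (fun N : ℕ => (N : ℝ) ^ γ)) :
    ∀ᶠ N in atTop, 0 < signal A N := by
  obtain ⟨K, hK, h⟩ := eventually_mul_rpow_le (signal_nonneg A) hs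
  filter_upwards [h, eventually_gt_atTop 0] with N h1 hN
  have hN' : (0 : ℝ) < N := by exact_mod_cast hN
  exact lt_of_lt_of_le (by positivity) h1

/-- In the mixture model almost all of the signal sits where the projection vanishes. -/
lemma eventually_mul_signal_le
    (hdisj : ∀ N, DisjointSupports ![C₁ N, C₂ N, P₀ N, Q₀ N])
    (hp₂ : ∀ N, p₂ N ∈ Set.Ioo (1 / 2 : ℝ) 1)
    (hp₂' : (fun N : ℕ => p₂ N - 1 / 2) =o[atTop] (fun N : ℕ => ((N : ℝ))⁻¹))
    (hA : A ∈ mixtureClass C₁ C₂ P₀ Q₀ p₂) (hγ : -1 < γ)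
    (hs : signal A =Θ[atTop] (fun N : ℕ => (N : ℝ) ^ γ)) {η : ℝ} (hη : 0 < η) :
    ∀ᶠ N in atTop, (1 - η) * signal A N ≤
      ((A N).1 : Measure X).real {z | bayesProjection (A N).1 (A N).2 z ≤ 0} := by
  obtain ⟨p₁, hp₁⟩ := hA
  have hlit : (fun N : ℕ => ((N : ℝ))⁻¹) =O[atTop] (fun N : ℕ => (N : ℝ) ^ γ) := by
    refine IsBigO.of_bound 1 ?_
    filter_upwards [eventually_ge_atTop 1] with N hN
    have hN' : (1 : ℝ) ≤ N := by exact_mod_cast hN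
    rw [Real.norm_of_nonneg (by positivity), Real.norm_of_nonneg (by positivity), one_mul,
      ← Real.rpow_neg_one]
    exact Real.rpow_le_rpow_of_exponent_le hN' hγ.le
  -- This is where `γ > -1` meets `p₂ - 1/2 = o(1/N)`: the imbalance is negligible against the
  -- signal.
  have ho : (fun N : ℕ => p₂ N - 1 / 2) =o[atTop] signal A :=
    (hp₂'.trans_isBigO hlit).trans_isBigO hs.2
  filter_upwards [ho.bound (half_pos hη)] with N hN
  rw [Real.norm_of_nonneg (signal_nonneg A N)] at hN
  have h1 := (le_abs_self _).trans hN
  obtain ⟨h2, h3, h4⟩ := hp₁ N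
  have h5 : signal A N ≤ _ := tvDist_le_of_mixture (hdisj N) h2 (hp₂ N) h3 h4
  linarith

lemma tendsto_mul_measureReal {F : ℕ → ℝ}
    (hL : Tendsto (fun N => (m N : ℝ) * signal A N) atTop atTop)
    (hF : ∀ᶠ N in atTop, (1 - 1 / 2) * signal A N ≤ F N) :
    Tendsto (fun N => (m N : ℝ) * F N) atTop atTop := by
  refine tendsto_atTop_mono' _ ?_ (hL.const_mul_atTop (show (0 : ℝ) < 1 / 2 by norm_num))
  filter_upwards [hF] with N h
  nlinarith [Nat.cast_nonneg (α := ℝ) (m N)]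

/-- The cutoff estimator at `0` detects every signal of larger order than `1 / N`. -/
lemma detects_cutoffEstimator (hc : 0 < c)
    (hm : Tendsto (fun N : ℕ => (m N : ℝ) / N) atTop (𝓝 c))
    (hdisj : ∀ N, DisjointSupports ![C₁ N, C₂ N, P₀ N, Q₀ N])
    (hp₂ : ∀ N, p₂ N ∈ Set.Ioo (1 / 2 : ℝ) 1)
    (hp₂' : (fun N : ℕ => p₂ N - 1 / 2) =o[atTop] (fun N : ℕ => ((N : ℝ))⁻¹))
    (hA : A ∈ mixtureClass C₁ C₂ P₀ Q₀ p₂) (hγ : -1 < γ)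
    (hs : signal A =Θ[atTop] (fun N : ℕ => (N : ℝ) ^ γ)) (hε : 0 < ε) (hε1 : ε ≤ 1) :
    Detects m n A (fun _ => cutoffEstimator X α 0) ε := by
  have hL := tendsto_mul_signal hc hm hγ hs
  refine detects_of_eventually m n A _ (η := ε / 4) (by positivity) (tendsto_mul_measureReal hL
    (eventually_mul_signal_le hdisj hp₂ hp₂' hA hγ hs (by norm_num))) ?_
  set qn := normalQuantile (1 - α) with hqn
  filter_upwards [eventually_mul_signal_le hdisj hp₂ hp₂' hA hγ hs (η := ε / 4) (by positivity),
    eventually_signal_pos hs, hL.eventually_ge_atTop (qn ^ 2 / (ε / 4) ^ 2),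
    hL.eventually_gt_atTop 0] with N hF hpos hbig hL0 u v hT hv
  have hm0 : (0 : ℝ) < m N := by
    by_contra! h
    nlinarith
  have hFle : _ ≤ signal A N := measureReal_bayesProjection_le_tvDist (A N).1 (A N).2
  have hQ0 := measure_right_bayesProjection_le_zero (A N).1 (A N).2
  set P := (A N).1
  set Q := (A N).2
  have hFdef : projCdf P (bayesProjection P Q) 0 =
    (P : Measure X).real {z | bayesProjection P Q z ≤ 0} := rfl
  have hGdef : projCdf Q (bayesProjection P Q) 0 = 0 := by
    rw [projCdf, measureReal_def, hQ0]; rfl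
  set F := (P : Measure X).real {z | bayesProjection P Q z ≤ 0}
  have hF0 : 0 ≤ F := measureReal_nonneg
  have hempv : empCdf (bayesProjection P Q) v 0 = 0 := by
    have : (Finset.univ.filter fun j => bayesProjection P Q (v j) ≤ 0) = ∅ :=
      Finset.filter_eq_empty_iff.2 fun j _ => not_le.2 (hv j)
    rw [empCdf, this]
    simp
  have hempu : (1 - ε / 4) * F < empCdf (bayesProjection P Q) u 0 := by
    rw [countIn_setOf_eq_card] at hT
    rw [empCdf, one_div, inv_mul_eq_div, lt_div_iff₀ hm0]
    linarith
  -- `G(0) = 0` removes the second variance, and `F(1 - F) ≤ F ≤ λ`.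
  have hsd : sdev P Q (bayesProjection P Q) (m N) (n N) 0 ≤ Real.sqrt (signal A N / m N) := by
    unfold sdev
    rw [hFdef, hGdef]
    refine Real.sqrt_le_sqrt ?_
    simp only [zero_mul, zero_div, add_zero]
    gcongr
    nlinarith
  have hqs : qn * sdev P Q (bayesProjection P Q) (m N) (n N) 0 ≤ ε / 4 * signal A N := by
    calc qn * sdev P Q (bayesProjection P Q) (m N) (n N) 0
        ≤ |qn| * Real.sqrt (signal A N / m N) := by
          refine mul_le_mul (le_abs_self _) hsd (Real.sqrt_nonneg _) (abs_nonneg _)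
      _ ≤ ε / 4 * signal A N := by
          -- After squaring, this is the lower bound `hbig` on `mλ`.
          refine (pow_le_pow_iff_left₀ (by positivity) (by positivity) two_ne_zero).1 ?_
          rw [mul_pow, sq_abs, Real.sq_sqrt (by positivity), mul_div_assoc', div_le_iff₀ hm0]
          rw [div_le_iff₀ (by positivity)] at hbig
          nlinarith
  change _ < empCdf (bayesProjection P Q) u 0 - empCdf (bayesProjection P Q) v 0
    - qn * sdev P Q (bayesProjection P Q) (m N) (n N) 0
  rw [hempv]
  have h1 : (1 - ε / 4) * ((1 - ε / 4) * signal A N) ≤ (1 - ε / 4) * F :=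
    mul_le_mul_of_nonneg_left hF (by linarith)
  -- The losses fit: `(1 - ε/4)² - ε/4 > 1 - ε`.
  nlinarith [mul_pos hε hpos, mul_pos (mul_pos hε hε) hpos]

/-! ### Lower bounds for the adaptive estimator -/

/-- The defining condition of the adaptive estimator holds at `l = 1`. -/
lemma countFirst_le_boundingFunction_one (hα : α ∈ Set.Ioo (0 : ℝ) 1) {k l : ℕ}
    (e : Fin (k + l) ≃ Fin k ⊕ Fin l) (z : ℕ) :
    (countFirst e z : ℝ) ≤ boundingFunction α x k l z 1 := by
  obtain ⟨h1, h2⟩ := countFirst_le e z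
  have ha0 : 0 < 1 - α / 3 := by linarith [hα.2]
  have ha1 : 1 - α / 3 ≤ 1 := by linarith [hα.1]
  unfold boundingFunction
  dsimp only
  rw [binomialQuantile_one ha0 ha1, binomialQuantile_one ha0 ha1]
  split_ifs with h3 h4
  · exact_mod_cast h1
  · exact_mod_cast h2
  · omega

/-- A single test point, `z = T`, excludes every `l < b`. The set of feasible `l` is nonempty, so
its infimum inherits the bound. -/
lemma le_adaptiveEstimator {S : SortingRule} (hα : α ∈ Set.Ioo (0 : ℝ) 1)
    (P Q : ProbabilityMeasure X) {k l : ℕ} (hl : 0 < l) (u : Fin k → X) (v : Fin l → X)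
    (hv : ∀ j, 0 < bayesProjection P Q (v j)) {b : ℝ}
    (hT : 0 < countIn {z | bayesProjection P Q z ≤ 0} u)
    (hb : ∀ p : unitInterval, (p : ℝ) < b →
      boundingFunction α x k l (countIn {z | bayesProjection P Q z ≤ 0} u) p <
        countIn {z | bayesProjection P Q z ≤ 0} u) :
    b ≤ adaptiveEstimator X S α x P Q k l u v := by
  unfold adaptiveEstimator
  dsimp only
  set r : Fin k ⊕ Fin l → ℝ :=
    Sum.elim (fun i => bayesProjection P Q (u i)) (fun j => bayesProjection P Q (v j))
  refine le_csInf ⟨1, 1, rfl, fun z _ => countFirst_le_boundingFunction_one hα _ z⟩ ?_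
  rintro _ ⟨p, rfl, hp⟩
  by_contra! hlt
  have hcount := le_countFirst (S.arrange k l r) r (S.monotone k l r) (by simpa [r] using hv)
  have hTk : countIn {z | bayesProjection P Q z ≤ 0} u ≤ k := by
    unfold countIn
    exact (Finset.card_le_univ _).trans (by simp)
  have hTeq : (Finset.univ.filter fun i : Fin k => r (Sum.inl i) ≤ 0).card =
      countIn {z | bayesProjection P Q z ≤ 0} u := by
    rw [countIn_setOf_eq_card]
    rfl
  rw [hTeq] at hcount
  -- `T ≤ k + l - 1` because `T ≤ k` and the second sample is nonempty.
  have h1 := hp _ (Finset.mem_Icc.2 ⟨hT, by omega⟩)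
  have h2 := hb p hlt
  have h3 : (countIn {z | bayesProjection P Q z ≤ 0} u : ℝ) ≤
    countFirst (S.arrange k l r) (countIn {z | bayesProjection P Q z ≤ 0} u) := by
    exact_mod_cast hcount
  linarith

lemma eventually_sqrt_le_mul {b δ : ℝ} (hb : 0 < b) (hδ : 0 < δ) :
    ∀ᶠ t : ℝ in atTop, Real.sqrt ((t + 1) / b) ≤ δ * t := by
  filter_upwards [eventually_ge_atTop (2 / (b * δ ^ 2)), eventually_ge_atTop 1] with t h1 h2
  refine Real.sqrt_le_iff.2 ⟨by positivity, ?_⟩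
  rw [div_le_iff₀ (by positivity)] at h1
  rw [div_le_iff₀ hb]
  nlinarith

/-- Mean and fluctuation each use at most a quarter of `k`. Applied to both samples, this keeps
`m(l)` and `n(l)` comparable to `m` and `n`. -/
lemma binomialQuantile_le_half {p : unitInterval} (hα : 0 < α) (hp : (p : ℝ) ≤ 1 / 4) {k : ℕ}
    (hk : Real.sqrt (((k : ℝ) + 1) / (1 - (1 - α / 3))) ≤ 1 / 4 * k) :
    (binomialQuantile (1 - α / 3) p k : ℝ) ≤ k / 2 := by
  have hb : 0 < 1 - (1 - α / 3) := by linarith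
  have hk' : (0 : ℝ) ≤ k := Nat.cast_nonneg k
  have hkp : (k : ℝ) * p ≤ k * (1 / 4) := mul_le_mul_of_nonneg_left hp hk'
  have : Real.sqrt (((k : ℝ) * p + 1) / (1 - (1 - α / 3))) ≤ 1 / 4 * k :=
    (Real.sqrt_le_sqrt (div_le_div_of_nonneg_right (by linarith) hb.le)).trans hk
  linarith [binomialQuantile_le (show 1 - α / 3 < 1 by linarith) k p]

/-- Values of `l` well below the signal `s` violate the defining condition of the adaptive
estimator at `z = T`, when `T` is nearly as large as `k s`. -/
lemma boundingFunction_lt_of_le_signal {k l T : ℕ} {p : unitInterval} {s κ B : ℝ} (hα : 0 < α)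
    (hε : 0 < ε) (hκ : 0 < κ) (hB : 0 ≤ B) (hs : 0 ≤ s) (hs4 : s ≤ 1 / 4)
    (hp : (p : ℝ) ≤ (1 - ε / 2) * s) (hTk : T ≤ k) (hT : (1 - ε / 4) * (k * s) < T)
    (hk0 : (0 : ℝ) < k) (hl0 : (0 : ℝ) < l)
    (hq : Real.sqrt ((k * s + 1) / (1 - (1 - α / 3))) ≤ ε / 8 * (k * s))
    (hqk : Real.sqrt (((k : ℝ) + 1) / (1 - (1 - α / 3))) ≤ 1 / 4 * k)
    (hql : Real.sqrt (((l : ℝ) + 1) / (1 - (1 - α / 3))) ≤ 1 / 4 * l)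
    (hκl : κ * (k + l) ≤ (l : ℝ) / 2)
    (hband : ∀ t : ℝ, (k : ℝ) / 2 ≤ t → t ≤ k → bandFactor x t ≤ B)
    (hBs : B ^ 2 < κ ^ 2 * (ε / 8 * (k * s))) :
    boundingFunction α x k l T p < T := by
  have hb : 0 < 1 - (1 - α / 3) := by linarith
  have hp4 : (p : ℝ) ≤ 1 / 4 := hp.trans (le_trans (by nlinarith) hs4)
  have hkp : (k : ℝ) * p ≤ k * ((1 - ε / 2) * s) := mul_le_mul_of_nonneg_left hp hk0.le
  have hks : 0 ≤ k * s := by positivity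
  have hkp' : (k : ℝ) * p ≤ k * s := hkp.trans (by nlinarith)
  have hq1 : (binomialQuantile (1 - α / 3) p k : ℝ) ≤
      k * ((1 - ε / 2) * s) + ε / 8 * (k * s) := by
    refine (binomialQuantile_le (by linarith) _ p).trans (add_le_add hkp (le_trans ?_ hq))
    exact Real.sqrt_le_sqrt (div_le_div_of_nonneg_right (by linarith) hb.le)
  have hqk2 := binomialQuantile_le_half hα hp4 hqk
  have hql2 := binomialQuantile_le_half hα hp4 hql
  set q := binomialQuantile (1 - α / 3) p k with hqdef
  -- `(1 - ε/4) - (1 - ε/2) - ε/8 = ε/8`.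
  have hTq : ε / 8 * (k * s) < T - q := by linarith
  have hqle : q ≤ k := by
    have : (q : ℝ) ≤ k := by linarith
    exact_mod_cast this
  refine boundingFunction_lt_self (κ := κ) (B := B) ?_ hTk ?_ hκ hB ?_ ?_ ?_
  · have : 0 ≤ ε / 8 * (k * s) := by positivity
    have : (q : ℝ) < T := by linarith
    exact_mod_cast this
  · have : (binomialQuantile (1 - α / 3) p l : ℝ) < l := by linarith
    exact_mod_cast this
  · linarith
  · have hq0 : (0 : ℝ) ≤ q := Nat.cast_nonneg _
    rw [← hqdef, Nat.cast_sub hqle]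
    exact hband _ (by linarith) (by linarith)
  · exact hBs.trans (mul_lt_mul_of_pos_left hTq (by positivity))

/-- The adaptive estimator detects every signal of larger order than `1 / N`. -/
lemma detects_adaptiveEstimator {S : SortingRule} (hc : c ∈ Set.Ioo (0 : ℝ) 1)
    (hmn : ∀ N, m N + n N = N)
    (hm : Tendsto (fun N : ℕ => (m N : ℝ) / N) atTop (𝓝 c))
    (hdisj : ∀ N, DisjointSupports ![C₁ N, C₂ N, P₀ N, Q₀ N])
    (hp₂ : ∀ N, p₂ N ∈ Set.Ioo (1 / 2 : ℝ) 1)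
    (hp₂' : (fun N : ℕ => p₂ N - 1 / 2) =o[atTop] (fun N : ℕ => ((N : ℝ))⁻¹))
    (hα : α ∈ Set.Ioo (0 : ℝ) 1)
    (hA : A ∈ mixtureClass C₁ C₂ P₀ Q₀ p₂) (hγ : γ ∈ Set.Ioo (-1 : ℝ) 0)
    (hs : signal A =Θ[atTop] (fun N : ℕ => (N : ℝ) ^ γ)) (hε : 0 < ε) (hε1 : ε ≤ 1) :
    Detects m n A (fun _ => adaptiveEstimator X S α x) ε := by
  obtain ⟨hc0, hc1⟩ := hc
  have hα0 := hα.1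
  have hL := tendsto_mul_signal hc0 hm hγ.1 hs
  refine detects_of_eventually m n A _ (η := ε / 8) (by positivity) (tendsto_mul_measureReal hL
    (eventually_mul_signal_le hdisj hp₂ hp₂' hA hγ.1 hs (by norm_num))) ?_
  have hn : Tendsto (fun N : ℕ => (n N : ℝ) / N) atTop (𝓝 (1 - c)) := by
    refine (hm.const_sub 1).congr' ?_
    filter_upwards [eventually_gt_atTop 0] with N hN
    have hN' : (0 : ℝ) < N := by exact_mod_cast hN
    have : (m N : ℝ) + n N = N := by exact_mod_cast hmn N
    field_simp
    linarith
  have hmle := eventually_mul_le_of_tendsto_div (half_lt_self hc0) hm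
  have hnle := eventually_mul_le_of_tendsto_div (half_lt_self (sub_pos.2 hc1)) hn
  have hcast : Tendsto (fun N : ℕ => (N : ℝ)) atTop atTop := tendsto_natCast_atTop_atTop
  have hmtop : Tendsto (fun N => (m N : ℝ)) atTop atTop :=
    tendsto_atTop_mono' _ hmle (hcast.const_mul_atTop (by linarith))
  have hntop : Tendsto (fun N => (n N : ℝ)) atTop atTop :=
    tendsto_atTop_mono' _ hnle (hcast.const_mul_atTop (by linarith))
  obtain ⟨K, hK, hKle⟩ := exists_mul_rpow_le_mul_signal hc0 hm hs
  -- The squared band width is then at most `N ^ (2δ)`, half the exponent of `mλ ≳ N ^ (1 + γ)`.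
  set δ := (1 + γ) / 4 with hδdef
  have hδ : 0 < δ := by have := hγ.1; rw [hδdef]; linarith
  obtain ⟨k₀, hk₀⟩ := eventually_atTop.1 (eventually_bandFactor_le_rpow x hδ)
  -- Eventually `n ≥ (1 - c) N / 2`, and the quantile removes at most half of `n`.
  set κ := (1 - c) / 4 with hκdef
  have hκ : 0 < κ := by rw [hκdef]; linarith
  have hpow : ∀ᶠ N : ℕ in atTop, ((N : ℝ) ^ δ) ^ 2 < κ ^ 2 * (ε / 8 * (K * (N : ℝ) ^ (1 + γ))) := by
    have hC : 0 < κ ^ 2 * (ε / 8 * K) := by positivity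
    have ht := (tendsto_rpow_atTop (show 0 < 2 * δ by linarith)).comp hcast
    filter_upwards [ht.eventually_gt_atTop (κ ^ 2 * (ε / 8 * K))⁻¹, eventually_gt_atTop 0]
      with N h1 hN
    have hN' : (0 : ℝ) < N := by exact_mod_cast hN
    have e1 : ((N : ℝ) ^ δ) ^ 2 = (N : ℝ) ^ (2 * δ) := by
      rw [sq, ← Real.rpow_add hN']; ring_nf
    have e2 : (N : ℝ) ^ (1 + γ) = (N : ℝ) ^ (2 * δ) * (N : ℝ) ^ (2 * δ) := by
      rw [← Real.rpow_add hN', hδdef]; ring_nf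
    rw [e1, e2]
    have hR : 0 < (N : ℝ) ^ (2 * δ) := by positivity
    have h1' : (κ ^ 2 * (ε / 8 * K))⁻¹ < (N : ℝ) ^ (2 * δ) := h1
    rw [inv_lt_iff_one_lt_mul₀ hC] at h1'
    nlinarith
  have hb : 0 < 1 - (1 - α / 3) := by linarith
  filter_upwards [eventually_mul_signal_le hdisj hp₂ hp₂' hA hγ.1 hs (η := ε / 8) (by positivity),
    eventually_signal_pos hs, hL.eventually (eventually_sqrt_le_mul hb (δ := ε / 8) (by positivity)),
    hmtop.eventually (eventually_sqrt_le_mul hb (δ := 1 / 4) (by norm_num)),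
    hntop.eventually (eventually_sqrt_le_mul hb (δ := 1 / 4) (by norm_num)),
    (tendsto_zero_of_isTheta_rpow hγ.2 hs).eventually_le_const (show (0 : ℝ) < 1 / 4 by norm_num),
    hnle, hKle, hpow, hmtop.eventually_ge_atTop (2 * k₀), hmtop.eventually_gt_atTop 0,
    hntop.eventually_gt_atTop 0, hL.eventually_gt_atTop 0]
    with N hF hpos hqL hqm hqn hsmall hnN hKN hpowN hk hm0 hn0 hL0 u v hT hv
  set P := (A N).1
  set Q := (A N).2
  set F := (P : Measure X).real {z | bayesProjection P Q z ≤ 0}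
  set T := countIn {z | bayesProjection P Q z ≤ 0} u with hTdef
  have hTm : T ≤ m N := by
    rw [hTdef, countIn_setOf_eq_card]
    exact (Finset.card_le_univ _).trans (by simp)
  -- One factor `1 - ε/8` comes from the mass of the zero region, the other from concentration; `(1
  -- - ε/8)² > 1 - ε/4`.
  have hTL : (1 - ε / 4) * (m N * signal A N) < T := by
    have h1 : (1 - ε / 8) * (m N * ((1 - ε / 8) * signal A N)) ≤ (1 - ε / 8) * (m N * F) :=
      mul_le_mul_of_nonneg_left (mul_le_mul_of_nonneg_left hF hm0.le) (by linarith)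
    nlinarith [mul_pos (mul_pos hε hε) hL0]
  have hT0 : 0 < T := by
    have : (0 : ℝ) < T := lt_of_le_of_lt (mul_nonneg (by linarith) hL0.le) hTL
    exact_mod_cast this
  have hNcast : (m N : ℝ) + n N = N := by exact_mod_cast hmn N
  -- The infimum satisfies only a weak inequality, so strictness comes from the gap between `1 - ε`
  -- and `1 - ε/2`.
  refine lt_of_lt_of_le (b := (1 - ε / 2) * signal A N) (by nlinarith [mul_pos hε hpos])
    (le_adaptiveEstimator hα P Q (by exact_mod_cast hn0) u v hv hT0 fun p hp => ?_)
  refine boundingFunction_lt_of_le_signal (B := (N : ℝ) ^ δ) hα0 hε hκ (by positivity) hpos.le hsmall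
    hp.le hTm hTL
    hm0 hn0 hqL hqm hqn ?_ ?_ ?_
  · rw [hNcast, hκdef]
    linarith
  · intro t ht htm
    have ht0 : 0 ≤ t := by linarith
    exact (hk₀ t (by linarith)).trans (Real.rpow_le_rpow ht0 (by linarith) hδ.le)
  · exact hpowN.trans_le (mul_le_mul_of_nonneg_left (by gcongr) (by positivity))

end Detection

end HPLB

theorem mainTheorem9 {X : Type*} [MeasurableSpace X]
    (m n : ℕ → ℕ) (hmn : ∀ N, m N + n N = N)
    (c : ℝ) (hc : c ∈ Set.Ioo (0 : ℝ) 1)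
    (hm : Filter.Tendsto (fun N : ℕ => (m N : ℝ) / N) Filter.atTop (nhds c))
    (C₁ C₂ P₀ Q₀ : ℕ → MeasureTheory.ProbabilityMeasure X)
    (hdisj : ∀ N, HPLB.DisjointSupports ![C₁ N, C₂ N, P₀ N, Q₀ N])
    (p₂ : ℕ → ℝ) (hp₂ : ∀ N, p₂ N ∈ Set.Ioo (1 / 2 : ℝ) 1)
    (hp₂' : Asymptotics.IsLittleO Filter.atTop (fun N : ℕ => p₂ N - 1 / 2)
      (fun N : ℕ => ((N : ℝ))⁻¹))
    (S : HPLB.SortingRule) (α : ℝ) (hα : α ∈ Set.Ioo (0 : ℝ) 1) (x : ℝ)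
    (ε : ℝ) (hε : ε ∈ Set.Ioc (0 : ℝ) 1) :
    HPLB.rate m n (HPLB.mixtureClass C₁ C₂ P₀ Q₀ p₂) (HPLB.adaptiveEstimator X S α x) ε =
        HPLB.oracleRate m n (HPLB.mixtureClass C₁ C₂ P₀ Q₀ p₂) α ε ∧
      HPLB.oracleRate m n (HPLB.mixtureClass C₁ C₂ P₀ Q₀ p₂) α ε = -1 := by
  have ho := HPLB.oracleRate_eq_neg_one (α := α) (ε := ε) (m := m) (n := n)
    fun γ hγ A hA hs =>
      HPLB.detects_cutoffEstimator hc.1 hm hdisj hp₂ hp₂' hA hγ.1 hs hε.1 hε.2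
  refine ⟨?_, ho⟩
  rw [ho]
  exact HPLB.rate_eq_neg_one fun γ hγ A hA hs =>
    HPLB.detects_adaptiveEstimator hc hmn hm hdisj hp₂ hp₂' hα hA hγ hs hε.1 hε.2
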